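/- Let $(R,\mathfrak m,k)$ be a noetherian local ring. **Definitions.** Let $M$ be a finitely generated $R$-module with minimal free resolution $F=(\cdots\to F_1\to F_0\to 0)$. Filter $F$ by the subcomplexes $\mathcal F^nF$ with $(\mathcal F^nF)_i=\mathfrak m^{n-i}F_i$ for $i\le n$ and $(\mathcal F^nF)_i=F_i$ for $i\ge n$. The *linear part* of $F$ is the complex $\operatorname{lin}^RF=\bigoplus_{n\ge 0}\mathcal F^nF/\mathcal F^{n+1}F$, and the *linearity defect* of $M$ is $\operatorname{ld}_RM=\sup\{i: H_i(\operatorname{lin}^RF)\ne 0\}\in\mathbb N\cup\{\infty\}$, with $\operatorname{ld}_R 0=0$. The module $M$ is *Koszul* if $\operatorname{ld}_RM=0$, and $R$ is *absolutely Koszul* if $\operatorname{ld}_RM<\infty$ for every finitely generated $R$-module $M$. Put $\beta_i(M)=\dim_k\operatorname{Tor}_i^R(k,M)$ for $i\ge0$ and $\beta_{-1}(M)=0$. If $M=M_1+M_2$, where $M_1,M_2$ are nonzero submodules of the nonzero finitely generated module $M$, this decomposition is a *Betti splitting* if $\beta_i(M)=\beta_i(M_1)+\beta_i(M_2)+\beta_{i-1}(M_1\cap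 M_2)$ for all $i\ge 0$. **Lemma.** Let $p,q\ge 1$ be integers and let $\varphi_1:R^p\to R^q$, $\varphi_2:R^q\to R^p$ be nonzero $R$-linear maps with $\varphi_1\circ\varphi_2=0$ and $\varphi_2\circ\varphi_1=0$. Assume that 1. neither $\operatorname{Im}\varphi_1$ nor $\operatorname{Im}\varphi_2$ is a Koszul module; 2. there are nonzero submodules $K_1\subseteq\operatorname{Ker}\varphi_2$ and $K_2\subseteq\operatorname{Ker}\varphi_1$ such that (a) $\operatorname{Ker}\varphi_1=\operatorname{Im}\varphi_2+K_2$ and $\operatorname{Ker}\varphi_2=\operatorname{Im}\varphi_1+K_1$ are Betti splittings, and (b) each of the modules $K_1\cap\operatorname{Im}\varphi_1$ and $K_2\cap\operatorname{Im}\varphi_2$ is either zero or Koszul. Then $\operatorname{ld}_R(\operatorname{Im}\varphi_1)=\operatorname{ld}_R(\operatorname{Im}\varphi_2)=\infty$. In particular, $R$ is not absolutely Koszul. -/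

import Mathlib

open IsLocalRing CategoryTheory

universe u

/-- A minimal free resolution
`⋯ → R^{rank 2} → R^{rank 1} → R^{rank 0} → M → 0` of a module `M` over a local ring `R`, by free
modules of finite rank: `F_i = R^{rank i}`, the differential `d i : F_{i+1} → F_i` satisfies
`d i (F_{i+1}) ⊆ 𝔪 F_i`. -/
structure MinimalFreeResolution (R : Type u) [CommRing R] [IsLocalRing R]
    (M : Type u) [AddCommGroup M] [Module R M] where
  rank : ℕ → ℕ
  d : ∀ i, (Fin (rank (i + 1)) → R) →ₗ[R] (Fin (rank i) → R)
  aug : (Fin (rank 0) → R) →ₗ[R] M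
  aug_surjective : Function.Surjective aug
  exact_zero : LinearMap.range (d 0) = LinearMap.ker aug
  exact_succ : ∀ i, LinearMap.range (d (i + 1)) = LinearMap.ker (d i)
  minimal : ∀ i, LinearMap.range (d i) ≤ maximalIdeal R • (⊤ : Submodule R (Fin (rank i) → R))

theorem mem_maximalIdeal_smul_top_of_forall {R : Type u} [CommRing R] [IsLocalRing R] {n : ℕ}
    (c : Fin n → R) (hc : ∀ i, c i ∈ maximalIdeal R) :
    c ∈ maximalIdeal R • (⊤ : Submodule R (Fin n → R)) := by
  have h : c = ∑ i, c i • (Pi.single i (1 : R) : Fin n → R) := by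
    ext j
    simp [Finset.sum_apply, Pi.single_apply]
  rw [h]
  exact Submodule.sum_mem _ fun i _ =>
    Submodule.smul_mem_smul (hc i) Submodule.mem_top

theorem exists_minimal_cover (R : Type u) [CommRing R] [IsLocalRing R]
    (M : Type u) [AddCommGroup M] [Module R M] [Module.Finite R M] :
    ∃ (n : ℕ) (f : (Fin n → R) →ₗ[R] M), Function.Surjective f ∧
      LinearMap.ker f ≤ maximalIdeal R • (⊤ : Submodule R (Fin n → R)) := by
  classical
  let b := Module.finBasis (ResidueField R) (TensorProduct R (ResidueField R) M)
  have hs : ∀ i, ∃ x : M, (1 : ResidueField R) ⊗ₜ[R] x = b i := fun i =>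
    TensorProduct.mk_surjective R M (ResidueField R) Ideal.Quotient.mk_surjective (b i)
  choose v hv using hs
  refine ⟨_, Fintype.linearCombination R v, ?_, ?_⟩
  · rw [← LinearMap.range_eq_top, Fintype.range_linearCombination]
    exact span_eq_top_of_tmul_eq_basis v b hv
  · intro c hc
    apply mem_maximalIdeal_smul_top_of_forall
    rw [LinearMap.mem_ker, Fintype.linearCombination_apply] at hc
    have h0 : ∑ i, residue R (c i) • b i = 0 := by
      have := congrArg (fun x : M => (1 : ResidueField R) ⊗ₜ[R] x) hc
      simp only [TensorProduct.tmul_sum, TensorProduct.tmul_smul, TensorProduct.tmul_zero,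
        hv] at this
      rw [← this]
      refine Finset.sum_congr rfl fun i _ => ?_
      rw [← ResidueField.algebraMap_eq, algebraMap_smul]
    intro i
    rw [← residue_eq_zero_iff]
    exact Fintype.linearIndependent_iff.1 b.linearIndependent _ h0 i

theorem exists_minimal_cover_submodule (R : Type u) [CommRing R] [IsLocalRing R]
    [IsNoetherianRing R] (s : Σ n : ℕ, Submodule R (Fin n → R)) :
    ∃ (m : ℕ) (f : (Fin m → R) →ₗ[R] (Fin s.1 → R)), LinearMap.range f = s.2 ∧
      LinearMap.ker f ≤ maximalIdeal R • (⊤ : Submodule R (Fin m → R)) := by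
  obtain ⟨m, f, hf, hk⟩ := exists_minimal_cover R s.2
  refine ⟨m, s.2.subtype ∘ₗ f, ?_, ?_⟩
  · rw [LinearMap.range_comp, LinearMap.range_eq_top.2 hf, Submodule.map_top,
      Submodule.range_subtype]
  · rwa [LinearMap.ker_comp_of_ker_eq_bot _ (Submodule.ker_subtype _)]

/-- A finitely generated module over a noetherian local ring has a minimal free resolution. -/
theorem nonempty_minimalFreeResolution (R : Type u) [CommRing R] [IsLocalRing R]
    [IsNoetherianRing R] (M : Type u) [AddCommGroup M] [Module R M] [Module.Finite R M] :
    Nonempty (MinimalFreeResolution R M) := by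
  obtain ⟨n, ε, hε, hk⟩ := exists_minimal_cover R M
  choose m f hf hm using exists_minimal_cover_submodule R
  let S : ℕ → Σ n : ℕ, Submodule R (Fin n → R) := fun i =>
    Nat.rec ⟨n, LinearMap.ker ε⟩ (fun _ s => ⟨m s, LinearMap.ker (f s)⟩) i
  have hS : ∀ i, (S i).2 ≤ maximalIdeal R • (⊤ : Submodule R (Fin (S i).1 → R)) := by
    intro i
    cases i with
    | zero => exact hk
    | succ i => exact hm (S i)
  exact ⟨{
    rank := fun i => (S i).1
    d := fun i => f (S i)
    aug := ε
    aug_surjective := hε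
    exact_zero := hf (S 0)
    exact_succ := fun i => hf (S (i + 1))
    minimal := fun i => (hf (S i)).trans_le (hS i) }⟩

namespace MinimalFreeResolution

variable {R : Type u} [CommRing R] [IsLocalRing R] {M : Type u} [AddCommGroup M] [Module R M]
  (F : MinimalFreeResolution R M)

/-- The degree `i` component `(ℱⁿF)_i` of the filtration of `F`: it is `F_i` for `i ≥ n` and
`𝔪^{n-i} F_i` for `i ≤ n`. The two cases agree with the formula below, because the subtraction
of natural numbers is truncated at `0`. -/
def filtration (n i : ℕ) : Submodule R (Fin (F.rank i) → R) :=
  maximalIdeal R ^ (n - i) • ⊤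

theorem d_mem_filtration (n i : ℕ) {x : Fin (F.rank (i + 1)) → R}
    (hx : x ∈ F.filtration n (i + 1)) : F.d i x ∈ F.filtration n i := by
  have h : F.filtration n (i + 1) ≤ (F.filtration n i).comap (F.d i) := by
    rw [← Submodule.map_le_iff_le_comap, filtration, filtration, Submodule.map_smul'',
      Submodule.map_top]
    refine (smul_mono_right _ (F.minimal i)).trans ?_
    rw [← Submodule.mul_smul, ← pow_succ]
    exact Submodule.smul_mono_left (Ideal.pow_le_pow_right (by omega))
  exact h hx

/-- The differential of `F`, restricted to the subcomplex `ℱⁿF`. -/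
def filtrationD (n i : ℕ) : F.filtration n (i + 1) →ₗ[R] F.filtration n i :=
  (F.d i).restrict fun _ hx => F.d_mem_filtration n i hx

/-- The degree `i` component of the complex `ℱⁿF / ℱⁿ⁺¹F`. -/
def LinPiece (n i : ℕ) : Type u :=
  F.filtration n i ⧸ (F.filtration (n + 1) i).submoduleOf (F.filtration n i)

instance (n i : ℕ) : AddCommGroup (F.LinPiece n i) :=
  inferInstanceAs (AddCommGroup
    (F.filtration n i ⧸ (F.filtration (n + 1) i).submoduleOf (F.filtration n i)))

instance (n i : ℕ) : Module R (F.LinPiece n i) :=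
  inferInstanceAs (Module R
    (F.filtration n i ⧸ (F.filtration (n + 1) i).submoduleOf (F.filtration n i)))

/-- The differential of the complex `ℱⁿF / ℱⁿ⁺¹F`. -/
def linPieceD (n i : ℕ) : F.LinPiece n (i + 1) →ₗ[R] F.LinPiece n i :=
  Submodule.mapQ _ _ (F.filtrationD n i) fun _ hx => F.d_mem_filtration (n + 1) i hx

/-- The degree `i` component of the linear part `lin F = ⨁ₙ ℱⁿF / ℱⁿ⁺¹F` of `F`. -/
abbrev Lin (i : ℕ) : Type u := DirectSum ℕ fun n => F.LinPiece n i

/-- The differential of the linear part of `F`. -/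
def linD (i : ℕ) : F.Lin (i + 1) →ₗ[R] F.Lin i :=
  DirectSum.lmap fun n => F.linPieceD n i

/-- The linear part of `F` is a complex. -/
theorem linD_comp_linD (i : ℕ) : F.linD i ∘ₗ F.linD (i + 1) = 0 := by
  have h : ∀ n y, F.linPieceD n i (F.linPieceD n (i + 1) y) = 0 := by
    intro n y
    obtain ⟨x, rfl⟩ := Submodule.Quotient.mk_surjective _ y
    have hx : F.filtrationD n i (F.filtrationD n (i + 1) x) = 0 := by
      apply Subtype.ext
      have : F.d (i + 1) x.1 ∈ LinearMap.ker (F.d i) := by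
        rw [← F.exact_succ i]
        exact ⟨_, rfl⟩
      exact this
    change Submodule.Quotient.mk (F.filtrationD n i (F.filtrationD n (i + 1) x)) = 0
    rw [hx, Submodule.Quotient.mk_zero]
  refine LinearMap.ext fun x => DFinsupp.ext fun n => ?_
  exact h n (x n)

/-- The cycles of degree `i` of the linear part of `F`; in degree `0` every element is a cycle. -/
def linCycles : ∀ i : ℕ, Submodule R (F.Lin i)
  | 0 => ⊤
  | i + 1 => LinearMap.ker (F.linD i)

/-- The homology `H_i(lin F)` of the linear part of `F`. -/
abbrev LinHomology (i : ℕ) : Type u :=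
  F.linCycles i ⧸ (LinearMap.range (F.linD i)).submoduleOf (F.linCycles i)

end MinimalFreeResolution

section

variable (R : Type u) [CommRing R] [IsLocalRing R]

/-- The minimal free resolution of a finitely generated module over a noetherian local ring
(it is unique up to isomorphism). -/
noncomputable def minimalFreeResolution [IsNoetherianRing R]
    (M : Type u) [AddCommGroup M] [Module R M] [Module.Finite R M] : MinimalFreeResolution R M :=
  (nonempty_minimalFreeResolution R M).some

/-- The linearity defect `ld_R M = sup {i : H_i(lin F) ≠ 0} ∈ ℕ ∪ {∞}`, with `F` the minimal free
resolution of `M`. If `M = 0`, then `F = 0`, and the supremum of the empty set is `0`. -/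
noncomputable def linearityDefect [IsNoetherianRing R]
    (M : Type u) [AddCommGroup M] [Module R M] [Module.Finite R M] : ℕ∞ :=
  ⨆ (i : ℕ) (_ : Nontrivial ((minimalFreeResolution R M).LinHomology i)), (i : ℕ∞)

/-- A finitely generated module is Koszul if its linearity defect is `0`. -/
def IsKoszulModule [IsNoetherianRing R]
    (M : Type u) [AddCommGroup M] [Module R M] [Module.Finite R M] : Prop :=
  linearityDefect R M = 0

/-- The ring `R` is absolutely Koszul if every finitely generated module has finite linearity
defect. -/
def IsAbsolutelyKoszul [IsNoetherianRing R] : Prop :=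
  ∀ (M : Type u) [AddCommGroup M] [Module R M] [Module.Finite R M], linearityDefect R M < ⊤

/-- The Betti number `β_i(M) = dim_k Tor_i^R(k, M)`. As `R` acts on `Tor_i^R(k, M)` through `k`,
its dimension over `k` is its length over `R`. -/
noncomputable def bettiNumber (M : Type u) [AddCommGroup M] [Module R M] (i : ℕ) : ℕ∞ :=
  Module.length R
    (((Tor (ModuleCat.{u} R) i).obj (ModuleCat.of R (ResidueField R))).obj (ModuleCat.of R M))

variable {R}

/-- For submodules of a finitely generated module, `M = M₁ + M₂` is a Betti splitting: the three
modules are nonzero, and `β_i(M) = β_i(M₁) + β_i(M₂) + β_{i-1}(M₁ ∩ M₂)` for all `i ≥ 0`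
(with `β_{-1} = 0`). -/
structure IsBettiSplitting {X : Type u} [AddCommGroup X] [Module R X] [Module.Finite R X]
    (M M₁ M₂ : Submodule R X) : Prop where
  ne_bot : M ≠ ⊥
  left_ne_bot : M₁ ≠ ⊥
  right_ne_bot : M₂ ≠ ⊥
  eq_sup : M = M₁ ⊔ M₂
  betti_zero : bettiNumber R M 0 = bettiNumber R M₁ 0 + bettiNumber R M₂ 0
  betti_succ : ∀ i, bettiNumber R M (i + 1) = bettiNumber R M₁ (i + 1) +
    bettiNumber R M₂ (i + 1) + bettiNumber R (M₁ ⊓ M₂ : Submodule R X) i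

end

/-! The proof is a descent: if `ld (Im φ₁) ≤ d + 1`, then `ld (Im φ₂) ≤ d`, and symmetrically.
Alternating the two implications lowers any finite bound to `0`, which is excluded because neither
image is Koszul.

For one descent step, `Ker φ₁` is a syzygy of `Im φ₁`, so the linear part of its minimal resolution
is exact in all degrees above `d` (`linExactAt_ker`). Let `A = Im φ₂ ∩ K₂`, with minimal resolution
`G`, and let `H` be the sum of the minimal resolutions of `Im φ₂` and `K₂`. The cone `C` of a lift
`G → H` of `A → Im φ₂ ⊕ K₂` resolves `Ker φ₁`, and the Betti splitting says exactly that `C` has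
minimal ranks, hence is minimal. Minimality of `C` forces the lift to have entries in `𝔪` in
positive degrees, so it induces a map from `H_j(lin G)` to `H_j(lin H)` for `j > 0`, whose cokernel
embeds in `H_j(lin C)`. Since `A` is zero or Koszul, `H_j(lin G) = 0` for `j > 0`, so vanishing
passes from `C` to `H` (`LinExactAt.of_cone`), then to the direct summand `Im φ₂`
(`LinExactAt.of_retract`). -/

/-! ### Dependent choice, lifting, and powers of an ideal -/

theorem exists_dependent_seq {α : ℕ → Type*} (P : ∀ i, α i → Prop)
    (r : ∀ i, α i → α (i + 1) → Prop) (h0 : ∃ a, P 0 a)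
    (hs : ∀ i a, P i a → ∃ b, P (i + 1) b ∧ r i a b) :
    ∃ f : ∀ i, α i, (∀ i, P i (f i)) ∧ ∀ i, r i (f i) (f (i + 1)) := by
  obtain ⟨a, ha⟩ := h0
  choose g hg hr using hs
  let s : ∀ i, { a : α i // P i a } := fun i =>
    Nat.rec ⟨a, ha⟩ (fun i x => ⟨g i x.1 x.2, hg i x.1 x.2⟩) i
  exact ⟨fun i => (s i).1, fun i => (s i).2, fun i => hr i (s i).1 (s i).2⟩

theorem exists_comp_eq_of_range_le {R P N L : Type*} [CommRing R] [AddCommGroup P] [Module R P]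
    [AddCommGroup N] [Module R N] [AddCommGroup L] [Module R L] [Module.Projective R P]
    (h : P →ₗ[R] L) (g : N →ₗ[R] L) (hr : LinearMap.range h ≤ LinearMap.range g) :
    ∃ f : P →ₗ[R] N, g ∘ₗ f = h := by
  obtain ⟨f, hf⟩ := Module.projective_lifting_property g.rangeRestrict
    (h.codRestrict (LinearMap.range g) fun x => hr ⟨x, rfl⟩) g.surjective_rangeRestrict
  refine ⟨f, LinearMap.ext fun x => ?_⟩
  exact congrArg Subtype.val (LinearMap.congr_fun hf x)

namespace Submodule

variable {R A B : Type*} [CommRing R] [AddCommGroup A] [Module R A] [AddCommGroup B] [Module R B]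

theorem map_mem_smul_top (f : A →ₗ[R] B) {I : Ideal R} {x : A}
    (hx : x ∈ I • (⊤ : Submodule R A)) : f x ∈ I • (⊤ : Submodule R B) := by
  have h := Submodule.mem_map_of_mem (f := f) hx
  rw [Submodule.map_smul''] at h
  exact (smul_mono_right I le_top : I • _ ≤ I • (⊤ : Submodule R B)) h

theorem map_mem_pow_succ_smul_top (f : A →ₗ[R] B) {I : Ideal R}
    (hf : LinearMap.range f ≤ I • (⊤ : Submodule R B)) {k l : ℕ} (hl : l ≤ k + 1) {x : A}
    (hx : x ∈ I ^ k • (⊤ : Submodule R A)) : f x ∈ I ^ l • (⊤ : Submodule R B) := by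
  have h := Submodule.mem_map_of_mem (f := f) hx
  rw [Submodule.map_smul'', Submodule.map_top] at h
  have h' := smul_mono_right (I ^ k) hf h
  rw [← Submodule.mul_smul, ← pow_succ] at h'
  exact Submodule.smul_mono_left (Ideal.pow_le_pow_right hl) h'

theorem prod_mem_smul_top {I : Ideal R} {x : A} {y : B}
    (hx : x ∈ I • (⊤ : Submodule R A)) (hy : y ∈ I • (⊤ : Submodule R B)) :
    (x, y) ∈ I • (⊤ : Submodule R (A × B)) := by
  have h := add_mem (map_mem_smul_top (LinearMap.inl R A B) hx)
    (map_mem_smul_top (LinearMap.inr R A B) hy)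
  simpa using h

end Submodule

/-- A resolution of `M` by free modules of finite rank, not necessarily minimal. -/
structure FreeResolution (R : Type u) [CommRing R] (M : Type u) [AddCommGroup M] [Module R M] where
  X : ℕ → ModuleCat.{u} R
  free : ∀ i, Module.Free R (X i)
  finite : ∀ i, Module.Finite R (X i)
  d : ∀ i, X (i + 1) →ₗ[R] X i
  aug : X 0 →ₗ[R] M
  aug_surjective : Function.Surjective aug
  exact_zero : LinearMap.range (d 0) = LinearMap.ker aug
  exact_succ : ∀ i, LinearMap.range (d (i + 1)) = LinearMap.ker (d i)

/-! ### Lifts, homotopies and mapping cones of free resolutions -/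

namespace FreeResolution

attribute [instance] FreeResolution.free FreeResolution.finite

section General

variable {R : Type u} [CommRing R] {M N : Type u} [AddCommGroup M] [Module R M]
  [AddCommGroup N] [Module R N]

theorem aug_d (P : FreeResolution R M) (x : P.X 1) : P.aug (P.d 0 x) = 0 := by
  have : P.d 0 x ∈ LinearMap.ker P.aug := P.exact_zero ▸ ⟨x, rfl⟩
  exact this

theorem d_d (P : FreeResolution R M) (i : ℕ) (x : P.X (i + 2)) : P.d i (P.d (i + 1) x) = 0 := by
  have : P.d (i + 1) x ∈ LinearMap.ker (P.d i) := P.exact_succ i ▸ ⟨x, rfl⟩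
  exact this

theorem exists_of_aug_eq_zero (P : FreeResolution R M) {x : P.X 0} (hx : P.aug x = 0) :
    ∃ y, P.d 0 y = x := by
  have : x ∈ LinearMap.range (P.d 0) := P.exact_zero ▸ hx
  exact this

theorem exists_of_d_eq_zero (P : FreeResolution R M) {i : ℕ} {x : P.X (i + 1)}
    (hx : P.d i x = 0) : ∃ y, P.d (i + 1) y = x := by
  have : x ∈ LinearMap.range (P.d (i + 1)) := P.exact_succ i ▸ hx
  exact this

theorem exists_lift (P : FreeResolution R M) (Q : FreeResolution R N) (φ : M →ₗ[R] N) :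
    ∃ f : ∀ i, P.X i →ₗ[R] Q.X i, (∀ x, Q.aug (f 0 x) = φ (P.aug x)) ∧
      ∀ i x, Q.d i (f (i + 1) x) = f i (P.d i x) := by
  obtain ⟨f₀, hf₀⟩ := exists_comp_eq_of_range_le (φ ∘ₗ P.aug) Q.aug
    (by rw [LinearMap.range_eq_top.2 Q.aug_surjective]; exact le_top)
  have hf₀' : ∀ x, Q.aug (f₀ x) = φ (P.aug x) := fun x => LinearMap.congr_fun hf₀ x
  obtain ⟨f, hf, hr⟩ := exists_dependent_seq (α := fun i => P.X i →ₗ[R] Q.X i)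
    -- The first clause is what makes the next lift possible. The second, vacuous for `i > 0`,
    -- carries the compatibility with the augmentations through the recursion.
    (fun i f => LinearMap.range (f ∘ₗ P.d i) ≤ LinearMap.range (Q.d i) ∧
      ∀ h : i = 0, ∀ x : P.X 0, Q.aug ((h ▸ f : P.X 0 →ₗ[R] Q.X 0) x) = φ (P.aug x))
    (fun i f g => ∀ x, Q.d i (g x) = f (P.d i x))
    ⟨f₀, by
      rintro _ ⟨x, rfl⟩
      apply Q.exists_of_aug_eq_zero
      simp [hf₀', P.aug_d], fun _ => hf₀'⟩ (by
      intro i f ⟨hf, _⟩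
      obtain ⟨g, hg⟩ := exists_comp_eq_of_range_le _ _ hf
      have hg' : ∀ x, Q.d i (g x) = f (P.d i x) := fun x => LinearMap.congr_fun hg x
      refine ⟨g, ⟨?_, by simp⟩, hg'⟩
      rintro _ ⟨x, rfl⟩
      apply Q.exists_of_d_eq_zero
      simp [hg', P.d_d])
  exact ⟨f, (hf 0).2 rfl, hr⟩

/-- A chain map between free resolutions that lifts the zero map is null-homotopic. -/
theorem exists_homotopy (P : FreeResolution R M) (Q : FreeResolution R N)
    (e : ∀ i, P.X i →ₗ[R] Q.X i) (h0 : ∀ x, Q.aug (e 0 x) = 0)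
    (hs : ∀ i x, Q.d i (e (i + 1) x) = e i (P.d i x)) :
    ∃ s : ∀ i, P.X i →ₗ[R] Q.X (i + 1),
      (∀ x, e 0 x = Q.d 0 (s 0 x)) ∧
      ∀ i x, e (i + 1) x = Q.d (i + 1) (s (i + 1) x) + s i (P.d i x) := by
  obtain ⟨s₀, hs₀⟩ := exists_comp_eq_of_range_le (e 0) (Q.d 0) (by
    rintro _ ⟨x, rfl⟩
    exact Q.exists_of_aug_eq_zero (h0 x))
  have hs₀' : ∀ x, Q.d 0 (s₀ x) = e 0 x := fun x => LinearMap.congr_fun hs₀ x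
  obtain ⟨s, hs, hr⟩ := exists_dependent_seq (α := fun i => P.X i →ₗ[R] Q.X (i + 1))
    -- This invariant makes `e (i + 1) - s ∘ P.d i` land in the cycles, hence in the boundaries, of
    -- `Q`.
    (fun i s => (∀ x, Q.d i (s (P.d i x)) = e i (P.d i x)) ∧
      ∀ h : i = 0, ∀ x : P.X 0, e 0 x = Q.d 0 ((h ▸ s : P.X 0 →ₗ[R] Q.X (0 + 1)) x))
    (fun i s t => ∀ x, e (i + 1) x = Q.d (i + 1) (t x) + s (P.d i x))
    ⟨s₀, fun x => hs₀' _, fun _ x => (hs₀' x).symm⟩ (by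
      intro i s ⟨h, _⟩
      obtain ⟨t, ht⟩ := exists_comp_eq_of_range_le (e (i + 1) - s ∘ₗ P.d i) (Q.d (i + 1)) (by
        rintro _ ⟨x, rfl⟩
        apply Q.exists_of_d_eq_zero
        simp [hs, h])
      have ht' : ∀ x, Q.d (i + 1) (t x) = e (i + 1) x - s (P.d i x) :=
        fun x => LinearMap.congr_fun ht x
      refine ⟨t, ⟨fun x => ?_, by simp⟩, fun x => ?_⟩
      · simp [ht', P.d_d]
      · simp [ht'])
  exact ⟨s, (hs 0).2 rfl, hr⟩

/-- If `M` is a retract of `N`, the identity of a resolution of `M` is homotopic to a map that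
factors through a given resolution of `N`. -/
theorem exists_retract (P : FreeResolution R M) (Q : FreeResolution R N) (φ : M →ₗ[R] N)
    (ψ : N →ₗ[R] M) (h : ψ ∘ₗ φ = LinearMap.id) :
    ∃ (a : ∀ i, P.X i →ₗ[R] Q.X i) (b : ∀ i, Q.X i →ₗ[R] P.X i)
      (s : ∀ i, P.X i →ₗ[R] P.X (i + 1)),
      (∀ i x, Q.d i (a (i + 1) x) = a i (P.d i x)) ∧
      (∀ i x, P.d i (b (i + 1) x) = b i (Q.d i x)) ∧
      (∀ x, b 0 (a 0 x) = x + P.d 0 (s 0 x)) ∧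
      ∀ i x, b (i + 1) (a (i + 1) x) = x + P.d (i + 1) (s (i + 1) x) + s i (P.d i x) := by
  obtain ⟨a, ha0, ha⟩ := exists_lift P Q φ
  obtain ⟨b, hb0, hb⟩ := exists_lift Q P ψ
  obtain ⟨s, hs0, hs⟩ := exists_homotopy P P (fun i => b i ∘ₗ a i - LinearMap.id)
    (fun x => by
      have := LinearMap.congr_fun h (P.aug x)
      rw [LinearMap.comp_apply, LinearMap.id_apply] at this
      simp [hb0, ha0, this])
    (fun i x => by simp [hb, ha])
  refine ⟨a, b, s, ha, hb, fun x => ?_, fun i x => ?_⟩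
  · rw [← hs0]
    simp
  · rw [add_assoc, ← hs]
    simp

/-- The product of two free resolutions. -/
def prod (P : FreeResolution R M) (Q : FreeResolution R N) : FreeResolution R (M × N) where
  X i := ModuleCat.of R (P.X i × Q.X i)
  free i := inferInstanceAs (Module.Free R (P.X i × Q.X i))
  finite i := inferInstanceAs (Module.Finite R (P.X i × Q.X i))
  d i := (P.d i).prodMap (Q.d i)
  aug := P.aug.prodMap Q.aug
  aug_surjective := P.aug_surjective.prodMap Q.aug_surjective
  exact_zero := by rw [LinearMap.range_prodMap, LinearMap.ker_prodMap, P.exact_zero, Q.exact_zero]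
  exact_succ i := by
    rw [LinearMap.range_prodMap, LinearMap.ker_prodMap, P.exact_succ, Q.exact_succ]

/-- The modules of the mapping cone. -/
def coneX (P : FreeResolution R M) (Q : FreeResolution R N) : ℕ → ModuleCat.{u} R
  | 0 => Q.X 0
  | i + 1 => ModuleCat.of R (Q.X (i + 1) × P.X i)

/-- The differential of the mapping cone. -/
def coneD (P : FreeResolution R M) (Q : FreeResolution R N) (f : ∀ i, P.X i →ₗ[R] Q.X i) :
    ∀ i, coneX P Q (i + 1) →ₗ[R] coneX P Q i
  | 0 => (Q.d 0).coprod (f 0)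
  | i + 1 => ((Q.d (i + 1)).coprod (f (i + 1))).prod (-(P.d i ∘ₗ LinearMap.snd R _ _))

/-- The mapping cone of a lift of the first map of a short exact sequence is a resolution of the
last module. -/
def cone {L : Type u} [AddCommGroup L] [Module R L] (P : FreeResolution R M)
    (Q : FreeResolution R N) (f : ∀ i, P.X i →ₗ[R] Q.X i) (ι : M →ₗ[R] N) (π : N →ₗ[R] L)
    (hι : Function.Injective ι) (hπ : Function.Surjective π)
    (hex : LinearMap.range ι = LinearMap.ker π)
    (h0 : ∀ x, Q.aug (f 0 x) = ι (P.aug x)) (hs : ∀ i x, Q.d i (f (i + 1) x) = f i (P.d i x)) :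
    FreeResolution R L where
  X := coneX P Q
  free
    | 0 => Q.free 0
    | i + 1 => inferInstanceAs (Module.Free R (Q.X (i + 1) × P.X i))
  finite
    | 0 => Q.finite 0
    | i + 1 => inferInstanceAs (Module.Finite R (Q.X (i + 1) × P.X i))
  d := coneD P Q f
  aug := π ∘ₗ Q.aug
  aug_surjective := hπ.comp Q.aug_surjective
  exact_zero := by
    apply le_antisymm
    · rintro _ ⟨⟨h, g⟩, rfl⟩
      change π (Q.aug (Q.d 0 h + f 0 g)) = 0
      rw [map_add, Q.aug_d, h0, zero_add]
      exact hex.le ⟨_, rfl⟩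
    · intro (x : Q.X 0) hx
      obtain ⟨m, hm⟩ := hex.ge (show Q.aug x ∈ LinearMap.ker π from hx)
      obtain ⟨g, rfl⟩ := P.aug_surjective m
      obtain ⟨h, hh⟩ := Q.exists_of_aug_eq_zero (x := x - f 0 g) (by
        rw [map_sub, h0, hm, sub_self])
      exact ⟨(h, g), show Q.d 0 h + f 0 g = x by rw [hh, sub_add_cancel]⟩
  exact_succ i := by
    apply le_antisymm
    · rintro _ ⟨⟨h, g⟩, rfl⟩
      match i with
      | 0 =>
        change Q.d 0 (Q.d 1 h + f 1 g) + f 0 (-P.d 0 g) = 0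
        rw [map_add, Q.d_d, hs, map_neg]
        abel
      | i + 1 =>
        change (Q.d (i + 1) (Q.d (i + 2) h + f (i + 2) g) + f (i + 1) (-P.d (i + 1) g),
          -P.d i (-P.d (i + 1) g)) = 0
        rw [map_add, Q.d_d, hs, map_neg, map_neg, P.d_d]
        simp
    · match i with
      | 0 =>
        rintro ⟨h, g⟩ hx
        replace hx : Q.d 0 h + f 0 g = 0 := hx
        -- Degree `1` is the only place where injectivity of `ι` enters: `f 0 g` is a boundary, so
        -- `ι` kills the augmentation of `g`.
        obtain ⟨g', hg'⟩ := P.exists_of_aug_eq_zero (x := g) (hι (by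
          rw [map_zero, ← h0, eq_neg_of_add_eq_zero_right hx, map_neg, Q.aug_d, neg_zero]))
        obtain ⟨h', hh'⟩ := Q.exists_of_d_eq_zero (x := h + f 1 g') (by
          rw [map_add, hs, hg', hx])
        refine ⟨(h', -g'), ?_⟩
        change (Q.d 1 h' + f 1 (-g'), -P.d 0 (-g')) = (h, g)
        simp [hh', hg']
      | i + 1 =>
        rintro ⟨h, g⟩ hx
        replace hx : (Q.d (i + 1) h + f (i + 1) g, -P.d i g) = 0 := hx
        rw [Prod.mk_eq_zero, neg_eq_zero] at hx
        obtain ⟨hx, hg⟩ := hx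
        obtain ⟨g', hg'⟩ := P.exists_of_d_eq_zero hg
        obtain ⟨h', hh'⟩ := Q.exists_of_d_eq_zero (x := h + f (i + 2) g') (by
          rw [map_add, hs, hg', hx])
        refine ⟨(h', -g'), ?_⟩
        change (Q.d (i + 2) h' + f (i + 2) (-g'), -P.d (i + 1) (-g')) = (h, g)
        simp [hh', hg']

/-- The modules of the complex obtained by adding a new module in degree `0`. -/
def consX (Y : ModuleCat.{u} R) (P : FreeResolution R M) : ℕ → ModuleCat.{u} R
  | 0 => Y
  | i + 1 => P.X i

/-- The differential of the complex obtained by adding a new module in degree `0`. -/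
def consD (Y : ModuleCat.{u} R) (P : FreeResolution R M) (ι : M →ₗ[R] Y) :
    ∀ i, consX Y P (i + 1) →ₗ[R] consX Y P i
  | 0 => ι ∘ₗ P.aug
  | i + 1 => P.d i

/-- A free resolution of the kernel of a surjection from a free module extends to a free resolution
of the image. -/
def cons (Y : Type u) [AddCommGroup Y] [Module R Y] [Module.Free R Y] [Module.Finite R Y]
    (P : FreeResolution R M) (ι : M →ₗ[R] Y) (π : Y →ₗ[R] N) (hι : Function.Injective ι)
    (hπ : Function.Surjective π) (hex : LinearMap.range ι = LinearMap.ker π) :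
    FreeResolution R N where
  X := consX (ModuleCat.of R Y) P
  free
    | 0 => ‹Module.Free R Y›
    | i + 1 => P.free i
  finite
    | 0 => ‹Module.Finite R Y›
    | i + 1 => P.finite i
  d := consD (ModuleCat.of R Y) P ι
  aug := π
  aug_surjective := hπ
  exact_zero := (LinearMap.range_comp_of_range_eq_top ι
    (LinearMap.range_eq_top.2 P.aug_surjective)).trans hex
  exact_succ
    | 0 => P.exact_zero.trans
        (LinearMap.ker_comp_of_ker_eq_bot P.aug (LinearMap.ker_eq_bot.2 hι)).symm
    | i + 1 => P.exact_succ i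

/-- The zero resolution of a zero module. -/
def zero [Subsingleton M] : FreeResolution R M where
  X _ := ModuleCat.of R PUnit
  free _ := inferInstanceAs (Module.Free R PUnit.{u + 1})
  finite _ := inferInstanceAs (Module.Finite R PUnit.{u + 1})
  d _ := 0
  aug := 0
  aug_surjective x := ⟨0, Subsingleton.elim _ _⟩
  exact_zero := by ext x; simp
  exact_succ i := by ext x; simp

end General

/-! ### Minimality and exactness of the linear part -/

section Local

variable {R : Type u} [CommRing R] [IsLocalRing R] {M N : Type u} [AddCommGroup M] [Module R M]
  [AddCommGroup N] [Module R N]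

/-- A free resolution is minimal if its differential vanishes modulo the maximal ideal. -/
def IsMinimal (P : FreeResolution R M) : Prop :=
  ∀ i, LinearMap.range (P.d i) ≤ maximalIdeal R • (⊤ : Submodule R (P.X i))

/-- The vanishing of the homology of the linear part in degree `i + 1`, in terms of elements. -/
def LinExactAt (P : FreeResolution R M) (i : ℕ) : Prop :=
  ∀ (n : ℕ) (x : P.X (i + 1)), x ∈ maximalIdeal R ^ (n - (i + 1)) • (⊤ : Submodule R (P.X (i + 1))) →
    P.d i x ∈ maximalIdeal R ^ (n + 1 - i) • (⊤ : Submodule R (P.X i)) →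
    ∃ y ∈ maximalIdeal R ^ (n - (i + 2)) • (⊤ : Submodule R (P.X (i + 2))),
      x - P.d (i + 1) y ∈ maximalIdeal R ^ (n + 1 - (i + 1)) • (⊤ : Submodule R (P.X (i + 1)))

/-- Linear maps preserve the `𝔪`-adic filtration, so a cycle can be moved to `Q`, bounded there, and
moved back; the homotopy terms disappear in the associated graded. Only one differential of `P` has
to be minimal and none of `Q`. With `φ = ψ = id` this compares two resolutions of the same module.
-/
theorem LinExactAt.of_retract {P : FreeResolution R M} {Q : FreeResolution R N} {i : ℕ}
    (hQ : Q.LinExactAt i) (φ : M →ₗ[R] N) (ψ : N →ₗ[R] M) (h : ψ ∘ₗ φ = LinearMap.id)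
    (hP : LinearMap.range (P.d (i + 1)) ≤ maximalIdeal R • (⊤ : Submodule R (P.X (i + 1)))) :
    P.LinExactAt i := by
  obtain ⟨a, b, s, ha, hb, -, hs⟩ := exists_retract P Q φ ψ h
  intro n x hx hdx
  obtain ⟨y, hy, hxy⟩ := hQ n (a (i + 1) x) (Submodule.map_mem_smul_top _ hx) (by
    rw [ha]
    exact Submodule.map_mem_smul_top _ hdx)
  refine ⟨b (i + 2) y, Submodule.map_mem_smul_top _ hy, ?_⟩
  have h1 := Submodule.map_mem_smul_top (b (i + 1)) hxy
  rw [map_sub, hs, ← hb] at h1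
  -- The term `d (s x)` gains a power of `𝔪` from minimality of `d`; the term `s (d x)` has it
  -- because `x` is a cycle of the graded piece.
  have h2 := Submodule.map_mem_pow_succ_smul_top (l := n + 1 - (i + 1)) (P.d (i + 1)) hP (by omega)
    (Submodule.map_mem_smul_top (s (i + 1)) hx)
  have h3 := Submodule.pow_smul_top_le (m := n + 1 - (i + 1)) (maximalIdeal R) _ (by omega)
    (Submodule.map_mem_smul_top (s i) hdx)
  convert sub_mem (sub_mem h1 h2) h3 using 1
  abel

theorem IsMinimal.prod {P : FreeResolution R M} {Q : FreeResolution R N} (hP : P.IsMinimal)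
    (hQ : Q.IsMinimal) : (P.prod Q).IsMinimal := by
  rintro i _ ⟨⟨x, y⟩, rfl⟩
  exact Submodule.prod_mem_smul_top (hP i ⟨x, rfl⟩) (hQ i ⟨y, rfl⟩)

/-- A free resolution with the same ranks as a minimal one is minimal. -/
theorem IsMinimal.of_finrank_eq {P Q : FreeResolution R M} (hP : P.IsMinimal)
    (h : ∀ i, Module.finrank R (P.X i) = Module.finrank R (Q.X i)) : Q.IsMinimal := by
  obtain ⟨a, b, s, -, hb, hs0, hs⟩ :=
    exists_retract P Q LinearMap.id LinearMap.id rfl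
  have hsub : ∀ i x, b i (a i x) - x ∈ maximalIdeal R • (⊤ : Submodule R (P.X i)) := by
    rintro (_ | i) x
    · rw [hs0, add_sub_cancel_left]
      exact hP 0 ⟨_, rfl⟩
    · rw [hs, add_assoc, add_sub_cancel_left]
      refine add_mem (hP _ ⟨_, rfl⟩) (Submodule.map_mem_smul_top _ (hP _ ⟨_, rfl⟩))
  -- Nakayama: `b i ∘ a i` is the identity modulo `𝔪`. Equal ranks then turn `b i` into a surjective
  -- endomorphism of a finite module, which is injective.
  have hsurj : ∀ i, Function.Surjective (b i) := by
    intro i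
    rw [← LinearMap.range_eq_top, eq_top_iff]
    apply Submodule.le_of_le_smul_of_le_jacobson_bot (I := maximalIdeal R)
      (Module.Finite.fg_top) (maximalIdeal_le_jacobson _)
    intro x _
    rw [← sub_sub_cancel (b i (a i x)) x]
    exact sub_mem (Submodule.mem_sup_left ⟨_, rfl⟩) (Submodule.mem_sup_right (hsub i x))
  have hinj : ∀ i, Function.Injective (b i) := by
    intro i
    let e := LinearEquiv.ofFinrankEq (P.X i) (Q.X i) (h i)
    have h1 : Function.Injective (b i ∘ₗ e.toLinearMap) :=
      OrzechProperty.injective_of_surjective_endomorphism _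
        ((hsurj i).comp e.surjective)
    intro x y hxy
    have := @h1 (e.symm x) (e.symm y) (by simpa using hxy)
    exact e.symm.injective this
  rintro i _ ⟨x, rfl⟩
  let e := LinearEquiv.ofBijective (b i) ⟨hinj i, hsurj i⟩
  have h1 : e (Q.d i x) ∈ maximalIdeal R • (⊤ : Submodule R (P.X i)) := by
    change b i (Q.d i x) ∈ _
    rw [← hb]
    exact hP i ⟨_, rfl⟩
  have h2 := Submodule.map_mem_smul_top e.symm.toLinearMap h1
  simpa using h2

/-- This is the segment `H(lin P) → H(lin Q) → H(lin C)` of a long exact sequence, all in degree `i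
+ 1`, for the cone `C`, carried out on elements. -/
theorem LinExactAt.of_cone {L : Type u} [AddCommGroup L] [Module R L] {P : FreeResolution R M}
    {Q : FreeResolution R N} {f : ∀ i, P.X i →ₗ[R] Q.X i} {ι : M →ₗ[R] N} {π : N →ₗ[R] L}
    {hι : Function.Injective ι} {hπ : Function.Surjective π}
    {hex : LinearMap.range ι = LinearMap.ker π}
    {h0 : ∀ x, Q.aug (f 0 x) = ι (P.aug x)} {hs : ∀ i x, Q.d i (f (i + 1) x) = f i (P.d i x)}
    (hmin : (cone P Q f ι π hι hπ hex h0 hs).IsMinimal) {i : ℕ} (hP : P.LinExactAt i)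
    (hC : (cone P Q f ι π hι hπ hex h0 hs).LinExactAt i) : Q.LinExactAt i := by
  -- The components of `f` in positive degrees are blocks of the minimal differential of the cone.
  have hf : ∀ i, LinearMap.range (f (i + 1)) ≤ maximalIdeal R • ⊤ := by
    rintro i _ ⟨x, rfl⟩
    have := Submodule.map_mem_smul_top (LinearMap.fst R (Q.X (i + 1)) (P.X i))
      (hmin (i + 1) ⟨((0 : Q.X (i + 2)), x), rfl⟩)
    change Q.d (i + 1) 0 + f (i + 1) x ∈ _ at this
    rwa [map_zero, zero_add] at this
  intro n x hx hdx
  obtain ⟨⟨h, g⟩, hy, hxy⟩ := hC n (x, (0 : P.X i))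
    (Submodule.prod_mem_smul_top hx (zero_mem _)) (by
      match i with
      | 0 =>
        change Q.d 0 x + f 0 0 ∈ _
        rwa [map_zero, add_zero]
      | i + 1 =>
        change (Q.d (i + 1) x + f (i + 1) 0, -P.d i 0) ∈ _
        rw [map_zero, map_zero, add_zero, neg_zero]
        exact Submodule.prod_mem_smul_top hdx (zero_mem _))
  have hh := Submodule.map_mem_smul_top (LinearMap.fst R (Q.X (i + 2)) (P.X (i + 1))) hy
  have hg := Submodule.map_mem_smul_top (LinearMap.snd R (Q.X (i + 2)) (P.X (i + 1))) hy
  have hx1 := Submodule.map_mem_smul_top (LinearMap.fst R (Q.X (i + 1)) (P.X i)) hxy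
  have hx2 := Submodule.map_mem_smul_top (LinearMap.snd R (Q.X (i + 1)) (P.X i)) hxy
  change h ∈ _ at hh
  change g ∈ _ at hg
  change x - (Q.d (i + 1) h + f (i + 1) g) ∈ _ at hx1
  change 0 - (-P.d i g) ∈ _ at hx2
  rw [zero_sub, neg_neg] at hx2
  match n with
  -- Here the truncated exponent `1 - (i + 1)` is `0`, so there is no condition on the difference.
  | 0 => exact ⟨0, zero_mem _, by simp⟩
  | n + 1 =>
    -- The cone shifts `P` by one, so its filtration index drops from `n + 1` to `n`. The
    -- `P`-component `g` of the bounding chain is a cycle of `lin P`, hence a boundary `d g'`, and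
    -- `f g` can be replaced by `d (f g')`.
    obtain ⟨g', hg', hgg⟩ := hP n g
      (Submodule.pow_smul_top_le _ _ (by omega) hg) (Submodule.pow_smul_top_le _ _ (by omega) hx2)
    refine ⟨h + f (i + 2) g', add_mem hh
      (Submodule.map_mem_pow_succ_smul_top _ (hf (i + 1)) (by omega) hg'), ?_⟩
    have h1 := Submodule.map_mem_pow_succ_smul_top (l := n + 1 + 1 - (i + 1)) _ (hf i)
      (by omega) hgg
    rw [map_sub, ← hs] at h1
    rw [map_add]
    convert add_mem hx1 h1 using 1
    abel

theorem linExactAt_zero [Subsingleton M] (i : ℕ) :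
    (zero : FreeResolution R M).LinExactAt i := by
  intro n x _ _
  have : x = 0 := Subsingleton.elim (α := PUnit) _ _
  exact ⟨0, zero_mem _, by simp [this]⟩

end Local

end FreeResolution

/-! ### Betti numbers as ranks of a minimal resolution -/

namespace FreeResolution
section
variable {R : Type u} [CommRing R] {M : Type u} [AddCommGroup M] [Module R M]

/-- The chain complex of a free resolution. -/
noncomputable def complex (P : FreeResolution R M) : ChainComplex (ModuleCat.{u} R) ℕ :=
  ChainComplex.of P.X (fun i => ModuleCat.ofHom (P.d i)) fun i => by
    ext x
    exact P.d_d i x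

theorem complex_d (P : FreeResolution R M) (i : ℕ) :
    P.complex.d (i + 1) i = ModuleCat.ofHom (P.d i) :=
  ChainComplex.of_d P.X (fun i => ModuleCat.ofHom (P.d i)) i

theorem complex_exactAt_succ (P : FreeResolution R M) (i : ℕ) : P.complex.ExactAt (i + 1) := by
  rw [HomologicalComplex.exactAt_iff' _ (i + 2) (i + 1) i (by simp) (by simp),
    ShortComplex.moduleCat_exact_iff]
  intro (x : P.X (i + 1)) hx
  change P.complex.d (i + 1) i x = 0 at hx
  rw [complex_d] at hx
  obtain ⟨y, hy⟩ := P.exists_of_d_eq_zero (i := i) hx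
  refine ⟨y, ?_⟩
  change P.complex.d (i + 2) (i + 1) y = x
  rw [complex_d]
  exact hy

/-- The augmentation of the chain complex of a free resolution. -/
noncomputable def complexAug (P : FreeResolution R M) :
    P.complex ⟶ (ChainComplex.single₀ (ModuleCat.{u} R)).obj (ModuleCat.of R M) :=
  (ChainComplex.toSingle₀Equiv _ _).symm ⟨ModuleCat.ofHom P.aug, by
    rw [complex_d]
    ext x
    exact P.aug_d x⟩

theorem complexAug_f_zero (P : FreeResolution R M) :
    P.complexAug.f 0 = ModuleCat.ofHom P.aug :=
  ChainComplex.toSingle₀Equiv_symm_apply_f_zero _ _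

instance (P : FreeResolution R M) : QuasiIso P.complexAug where
  quasiIsoAt n := by
    cases n with
    | zero =>
      rw [ChainComplex.quasiIsoAt₀_iff, ShortComplex.quasiIso_iff_of_zeros' _ rfl rfl rfl]
      constructor
      · rw [ShortComplex.moduleCat_exact_iff]
        intro (x : P.X 0) hx
        change P.complexAug.f 0 x = 0 at hx
        rw [complexAug_f_zero] at hx
        obtain ⟨y, hy⟩ := P.exists_of_aug_eq_zero hx
        refine ⟨y, ?_⟩
        change P.complex.d 1 0 y = x
        rw [complex_d]
        exact hy
      · change Epi (P.complexAug.f 0)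
        rw [complexAug_f_zero]
        exact (ModuleCat.epi_iff_surjective (ModuleCat.ofHom P.aug)).2 P.aug_surjective
    | succ n =>
      rw [quasiIsoAt_iff_exactAt' (hL := ChainComplex.exactAt_succ_single_obj ..)]
      exact P.complex_exactAt_succ n

/-- A free resolution as a projective resolution in the category of modules. -/
noncomputable def toProjectiveResolution (P : FreeResolution R M) :
    ProjectiveResolution (ModuleCat.of R M) where
  complex := P.complex
  projective i := by
    have : Module.Projective R (P.X i) := Module.Projective.of_free
    exact (IsProjective.iff_projective (P.X i)).1 this
  π := P.complexAug

end

section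
variable {R : Type u} [CommRing R] [IsLocalRing R] {M : Type u} [AddCommGroup M] [Module R M]

theorem IsMinimal.residueField_whiskerLeft_d {P : FreeResolution R M} (hP : P.IsMinimal)
    (i j : ℕ) : MonoidalCategoryStruct.whiskerLeft (ModuleCat.of R (ResidueField R))
      (P.complex.d i j) = 0 := by
  by_cases h : i = j + 1
  · subst h
    rw [complex_d]
    ext : 1
    refine TensorProduct.ext' fun a x => ?_
    change a ⊗ₜ[R] P.d j x = 0
    have hx : P.d j x ∈ maximalIdeal R • (⊤ : Submodule R (P.X j)) := hP j ⟨x, rfl⟩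
    refine Submodule.smul_induction_on (p := fun y => a ⊗ₜ[R] y = 0) hx
      (fun r hr y _ => ?_) fun y z hy hz => by rw [TensorProduct.tmul_add, hy, hz, add_zero]
    have : r • a = 0 := by
      rw [Algebra.smul_def, ResidueField.algebraMap_eq, (residue_eq_zero_iff r).2 hr, zero_mul]
    rw [← TensorProduct.smul_tmul, this, TensorProduct.zero_tmul]
  · rw [P.complex.shape i j (by simpa [eq_comm] using h)]
    simp

/-- Tensoring a minimal resolution with `k` kills its differential, so `Tor_i` is `k ⊗ P_i` itself.
-/
theorem IsMinimal.bettiNumber_eq {P : FreeResolution R M} (hP : P.IsMinimal) (i : ℕ) :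
    bettiNumber R M i = Module.finrank R (P.X i) := by
  let T := (MonoidalCategory.tensoringLeft (ModuleCat.{u} R)).obj
    (ModuleCat.of R (ResidueField R))
  let K := (T.mapHomologicalComplex (ComplexShape.down ℕ)).obj P.complex
  have e1 : ((Tor (ModuleCat.{u} R) i).obj (ModuleCat.of R (ResidueField R))).obj
      (ModuleCat.of R M) ≅ K.homology i :=
    P.toProjectiveResolution.isoLeftDerivedObj T i
  have hd : ∀ a b, K.d a b = 0 := fun a b => hP.residueField_whiskerLeft_d a b
  have e2 : K.homology i ≅ K.X i :=
    (ShortComplex.LeftHomologyData.ofZeros (K.sc i) (hd _ _) (hd _ _)).homologyIso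
  have e3 : TensorProduct R (ResidueField R) (P.X i) ≃ₗ[R]
      (Fin (Module.finrank R (P.X i)) → ResidueField R) :=
    (TensorProduct.congr (LinearEquiv.refl R _) (Module.finBasis R (P.X i)).equivFun) ≪≫ₗ
      TensorProduct.piScalarRight R R _ _
  have h1 : Module.length R (ResidueField R) = 1 := by
    have : IsSimpleModule R (R ⧸ maximalIdeal R) :=
      isSimpleModule_iff_isCoatom.2 (maximalIdeal.isMaximal R).out
    exact Module.length_eq_one R (R ⧸ maximalIdeal R)
  have h2 : bettiNumber R M i = Module.length R (TensorProduct R (ResidueField R) (P.X i)) :=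
    (e1 ≪≫ e2).toLinearEquiv.length_eq
  rw [h2, e3.length_eq, Module.length_pi_of_fintype]
  simp [h1]

end
end FreeResolution

/-! ### Elementwise exactness and the linearity defect -/

namespace MinimalFreeResolution

variable {R : Type u} [CommRing R] [IsLocalRing R] {M : Type u} [AddCommGroup M] [Module R M]

/-- A minimal free resolution as a free resolution. -/
def toFreeResolution (F : MinimalFreeResolution R M) : FreeResolution R M where
  X i := ModuleCat.of R (Fin (F.rank i) → R)
  free i := inferInstanceAs (Module.Free R (Fin (F.rank i) → R))
  finite i := inferInstanceAs (Module.Finite R (Fin (F.rank i) → R))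
  d := F.d
  aug := F.aug
  aug_surjective := F.aug_surjective
  exact_zero := F.exact_zero
  exact_succ := F.exact_succ

theorem isMinimal_toFreeResolution (F : MinimalFreeResolution R M) :
    F.toFreeResolution.IsMinimal := F.minimal

theorem linExactAt_iff_exact (F : MinimalFreeResolution R M) (i : ℕ) :
    F.toFreeResolution.LinExactAt i ↔
      ∀ n (z : F.LinPiece n (i + 1)), F.linPieceD n i z = 0 →
        ∃ y, F.linPieceD n (i + 1) y = z := by
  refine forall_congr' fun n => ⟨fun h z hz => ?_, fun h x hx hdx => ?_⟩
  · obtain ⟨x, rfl⟩ := Submodule.Quotient.mk_surjective _ z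
    have hdx : F.filtrationD n i x ∈ (F.filtration (n + 1) i).submoduleOf (F.filtration n i) :=
      (Submodule.Quotient.mk_eq_zero _).1 hz
    obtain ⟨y, hy, hxy⟩ := h x.1 x.2 hdx
    refine ⟨Submodule.Quotient.mk ⟨y, hy⟩, ?_⟩
    refine ((Submodule.Quotient.eq _).2 ?_).symm
    exact hxy
  · obtain ⟨y, hy⟩ := h (Submodule.Quotient.mk ⟨x, hx⟩) ((Submodule.Quotient.mk_eq_zero _).2 hdx)
    obtain ⟨y, rfl⟩ := Submodule.Quotient.mk_surjective _ y
    have hxy := (Submodule.Quotient.eq ((F.filtration (n + 1) (i + 1)).submoduleOf _)).1 hy.symm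
    exact ⟨y.1, y.2, hxy⟩

theorem linExactAt_iff_subsingleton (F : MinimalFreeResolution R M) (i : ℕ) :
    F.toFreeResolution.LinExactAt i ↔ Subsingleton (F.LinHomology (i + 1)) := by
  classical
  rw [linExactAt_iff_exact, Submodule.Quotient.subsingleton_iff, Submodule.submoduleOf_eq_top]
  constructor
  · intro h z hz
    have hz' : ∀ n, F.linPieceD n i (z n) = 0 := fun n => DFinsupp.ext_iff.1 hz n
    choose y hy using fun n => h n (z n) (hz' n)
    -- The chosen preimages of zero components may be nonzero, so they are cut off outside the
    -- support of `z`.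
    let w : Π₀ n, F.LinPiece n (i + 2) := DFinsupp.mk z.support fun n => y n
    refine ⟨w, DFinsupp.ext fun n => ?_⟩
    change F.linPieceD n (i + 1) (w n) = z n
    rw [DFinsupp.mk_apply]
    split_ifs with hn
    · exact hy n
    · rw [map_zero]
      exact (DFinsupp.notMem_support_iff.1 hn).symm
  · intro h n z hz
    obtain ⟨y, hy⟩ := @h (DirectSum.lof R ℕ (fun n => F.LinPiece n (i + 1)) n z) (by
      change F.linD i _ = 0
      rw [linD, DirectSum.lmap_lof, hz, map_zero])
    refine ⟨y n, ?_⟩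
    have := DFinsupp.ext_iff.1 hy n
    rw [DirectSum.lof_apply] at this
    exact this

end MinimalFreeResolution

section

variable (R : Type u) [CommRing R] [IsLocalRing R] [IsNoetherianRing R]
  (M : Type u) [AddCommGroup M] [Module R M] [Module.Finite R M]

theorem linearityDefect_le_iff (d : ℕ) : linearityDefect R M ≤ d ↔
    ∀ i, d ≤ i → (minimalFreeResolution R M).toFreeResolution.LinExactAt i := by
  simp only [linearityDefect, iSup_le_iff, MinimalFreeResolution.linExactAt_iff_subsingleton,
    ← not_nontrivial_iff_subsingleton]
  constructor
  · intro h i hi hn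
    have := h _ hn
    norm_cast at this
    omega
  · intro h i hn
    norm_cast
    by_contra hlt
    -- A degree above `d` is positive, so homology in degree `0` never matters for the bound.
    obtain ⟨j, rfl⟩ : ∃ j, i = j + 1 := ⟨i - 1, by omega⟩
    exact h j (by omega) hn

end

/-! ### Betti splittings, syzygies and the descent -/

section

variable {R : Type u} [CommRing R] [IsLocalRing R] [IsNoetherianRing R]

theorem isMinimal_minimalFreeResolution (M : Type u) [AddCommGroup M] [Module R M]
    [Module.Finite R M] : (minimalFreeResolution R M).toFreeResolution.IsMinimal :=
  MinimalFreeResolution.isMinimal_toFreeResolution _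

variable {X : Type u} [AddCommGroup X] [Module R X] [Module.Finite R X]

theorem linExactAt_of_eq_bot_or_isKoszulModule {A : Submodule R X}
    (h : A = ⊥ ∨ IsKoszulModule R A) (i : ℕ) :
    (minimalFreeResolution R A).toFreeResolution.LinExactAt i := by
  rcases h with rfl | h
  -- The chosen minimal resolution of the zero module is compared with the zero resolution.
  · exact (FreeResolution.linExactAt_zero (M := (⊥ : Submodule R X)) i).of_retract LinearMap.id
      LinearMap.id rfl (isMinimal_minimalFreeResolution _ _)
  · exact (linearityDefect_le_iff R A 0).1 (le_of_eq h) i (Nat.zero_le i)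

/-- In a Betti splitting whose intersection has linear part exact in a positive degree, exactness of
the linear part in that degree passes from the sum to the left summand. -/
theorem IsBettiSplitting.linExactAt_left {M M₁ M₂ : Submodule R X} (h : IsBettiSplitting M M₁ M₂)
    {i : ℕ}
    (hA : (minimalFreeResolution R (M₁ ⊓ M₂ : Submodule R X)).toFreeResolution.LinExactAt i)
    (hM : (minimalFreeResolution R M).toFreeResolution.LinExactAt i) :
    (minimalFreeResolution R M₁).toFreeResolution.LinExactAt i := by
  set A : Submodule R X := M₁ ⊓ M₂
  set G := (minimalFreeResolution R A).toFreeResolution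
  set H₁ := (minimalFreeResolution R M₁).toFreeResolution
  set H₂ := (minimalFreeResolution R M₂).toFreeResolution
  set F := (minimalFreeResolution R M).toFreeResolution
  have hG : G.IsMinimal := isMinimal_minimalFreeResolution _
  have hH₁ : H₁.IsMinimal := isMinimal_minimalFreeResolution _
  have hH₂ : H₂.IsMinimal := isMinimal_minimalFreeResolution _
  have hF : F.IsMinimal := isMinimal_minimalFreeResolution _
  let ι : A →ₗ[R] M₁ × M₂ :=
    (Submodule.inclusion inf_le_left).prod (-Submodule.inclusion inf_le_right)
  let π : M₁ × M₂ →ₗ[R] M :=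
    (Submodule.inclusion (le_sup_left.trans h.eq_sup.ge)).coprod
      (Submodule.inclusion (le_sup_right.trans h.eq_sup.ge))
  have hι : Function.Injective ι := fun x y hxy =>
    Submodule.inclusion_injective _ (congrArg Prod.fst hxy)
  have hπ : Function.Surjective π := by
    rintro ⟨x, hx⟩
    obtain ⟨y, hy, z, hz, rfl⟩ := Submodule.mem_sup.1 (h.eq_sup.le hx)
    exact ⟨(⟨y, hy⟩, ⟨z, hz⟩), rfl⟩
  have hex : LinearMap.range ι = LinearMap.ker π := by
    apply le_antisymm
    · rintro _ ⟨x, rfl⟩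
      apply Subtype.ext
      exact add_neg_cancel (x : X)
    · rintro ⟨⟨y, hy⟩, ⟨z, hz⟩⟩ hyz
      have hyz' : y + z = 0 := congrArg Subtype.val hyz
      have hz' : z = -y := eq_neg_of_add_eq_zero_right hyz'
      subst hz'
      exact ⟨⟨y, hy, by simpa using hz⟩, rfl⟩
  obtain ⟨f, h0, hs⟩ := G.exists_lift (H₁.prod H₂) ι
  -- The splitting identities say that the cone has the same ranks as the minimal resolution `F`.
  have hmin : (FreeResolution.cone G (H₁.prod H₂) f ι π hι hπ hex h0 hs).IsMinimal := by
    refine hF.of_finrank_eq fun j => ?_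
    match j with
    | 0 =>
      change _ = Module.finrank R (H₁.X 0 × H₂.X 0)
      have := h.betti_zero
      rw [hF.bettiNumber_eq, hH₁.bettiNumber_eq, hH₂.bettiNumber_eq] at this
      rw [Module.finrank_prod]
      exact_mod_cast this
    | j + 1 =>
      change _ = Module.finrank R ((H₁.X (j + 1) × H₂.X (j + 1)) × G.X j)
      have := h.betti_succ j
      rw [hF.bettiNumber_eq, hH₁.bettiNumber_eq, hH₂.bettiNumber_eq, hG.bettiNumber_eq] at this
      rw [Module.finrank_prod, Module.finrank_prod]
      exact_mod_cast this
  have hC := hM.of_retract (P := FreeResolution.cone G (H₁.prod H₂) f ι π hι hπ hex h0 hs)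
    LinearMap.id LinearMap.id rfl (hmin _)
  exact (FreeResolution.LinExactAt.of_cone hmin hA hC).of_retract (LinearMap.inl R M₁ M₂)
    (LinearMap.fst R M₁ M₂) (LinearMap.fst_comp_inl R M₁ M₂) (hH₁ _)

/-- Putting `Y` in degree `0` below a minimal resolution of the kernel resolves the image. The map
from `Y` need not be a minimal cover, but non-minimality can occur only in the lowest differential,
which the comparison in degree `i + 2` does not require to be minimal. -/
theorem linExactAt_ker {Y Z : Type u} [AddCommGroup Y] [Module R Y] [Module.Free R Y]
    [Module.Finite R Y] [AddCommGroup Z] [Module R Z] (φ : Y →ₗ[R] Z) {i : ℕ}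
    (h : (minimalFreeResolution R (LinearMap.range φ)).toFreeResolution.LinExactAt (i + 1)) :
    (minimalFreeResolution R (LinearMap.ker φ)).toFreeResolution.LinExactAt i := by
  set K := (minimalFreeResolution R (LinearMap.ker φ)).toFreeResolution
  let Q := FreeResolution.cons Y K (LinearMap.ker φ).subtype φ.rangeRestrict
    (Submodule.subtype_injective _) φ.surjective_rangeRestrict (by
      rw [Submodule.range_subtype, LinearMap.ker_rangeRestrict])
  have hQ : Q.LinExactAt (i + 1) := h.of_retract LinearMap.id LinearMap.id rfl
    (isMinimal_minimalFreeResolution (LinearMap.ker φ) (i + 1))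
  intro n x hx hdx
  obtain ⟨y, hy, hxy⟩ := hQ (n + 1) x
    (Submodule.pow_smul_top_le _ _ (by omega) hx) (Submodule.pow_smul_top_le _ _ (by omega) hdx)
  exact ⟨y, Submodule.pow_smul_top_le _ _ (by omega) hy,
    Submodule.pow_smul_top_le _ _ (by omega) hxy⟩

/-- The descent step: passing to the syzygy `Ker φ` lowers the bound by one, and passing to the
summand `Im ψ` of the splitting keeps it. -/
theorem linearityDefect_range_le_of_isBettiSplitting {Y : Type u} [AddCommGroup Y] [Module R Y]
    [Module.Free R X] [Module.Finite R Y] (φ : X →ₗ[R] Y) (ψ : Y →ₗ[R] X) {K : Submodule R X}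
    (hs : IsBettiSplitting (LinearMap.ker φ) (LinearMap.range ψ) K)
    (hK : K ⊓ LinearMap.range ψ = ⊥ ∨ IsKoszulModule R (K ⊓ LinearMap.range ψ : Submodule R X))
    {d : ℕ} (hd : linearityDefect R (LinearMap.range φ) ≤ (d + 1 : ℕ)) :
    linearityDefect R (LinearMap.range ψ) ≤ d := by
  rw [linearityDefect_le_iff] at hd ⊢
  intro i hi
  rw [inf_comm] at hK
  exact hs.linExactAt_left (linExactAt_of_eq_bot_or_isKoszulModule hK i)
    (linExactAt_ker φ (hd _ (by omega)))

end

theorem lemma3p2 (R : Type u) [CommRing R] [IsLocalRing R] [IsNoetherianRing R]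
    (p q : ℕ) (hp : 1 ≤ p) (hq : 1 ≤ q)
    (φ₁ : (Fin p → R) →ₗ[R] (Fin q → R)) (φ₂ : (Fin q → R) →ₗ[R] (Fin p → R))
    (hφ₁ : φ₁ ≠ 0) (hφ₂ : φ₂ ≠ 0) (h₁₂ : φ₁ ∘ₗ φ₂ = 0) (h₂₁ : φ₂ ∘ₗ φ₁ = 0)
    (hnk₁ : ¬ IsKoszulModule R (LinearMap.range φ₁))
    (hnk₂ : ¬ IsKoszulModule R (LinearMap.range φ₂))
    (K₁ : Submodule R (Fin q → R)) (K₂ : Submodule R (Fin p → R))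
    (hK₁ : K₁ ≠ ⊥) (hK₂ : K₂ ≠ ⊥)
    (hK₁_le : K₁ ≤ LinearMap.ker φ₂) (hK₂_le : K₂ ≤ LinearMap.ker φ₁)
    (hsplit₁ : IsBettiSplitting (LinearMap.ker φ₁) (LinearMap.range φ₂) K₂)
    (hsplit₂ : IsBettiSplitting (LinearMap.ker φ₂) (LinearMap.range φ₁) K₁)
    (hint₁ : K₁ ⊓ LinearMap.range φ₁ = ⊥ ∨
      IsKoszulModule R (K₁ ⊓ LinearMap.range φ₁ : Submodule R (Fin q → R)))
    (hint₂ : K₂ ⊓ LinearMap.range φ₂ = ⊥ ∨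
      IsKoszulModule R (K₂ ⊓ LinearMap.range φ₂ : Submodule R (Fin p → R))) :
    linearityDefect R (LinearMap.range φ₁) = ⊤ ∧ linearityDefect R (LinearMap.range φ₂) = ⊤ ∧
      ¬ IsAbsolutelyKoszul R := by
  -- Both images are treated in one induction, since each descent step exchanges them.
  have key : ∀ d : ℕ, ¬ linearityDefect R (LinearMap.range φ₁) ≤ d ∧
      ¬ linearityDefect R (LinearMap.range φ₂) ≤ d := by
    intro d
    induction d with
    | zero => exact ⟨fun h => hnk₁ (nonpos_iff_eq_zero.1 h), fun h => hnk₂ (nonpos_iff_eq_zero.1 h)⟩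
    | succ d ih =>
      exact ⟨fun h => ih.2 (linearityDefect_range_le_of_isBettiSplitting φ₁ φ₂ hsplit₁ hint₂ h),
        fun h => ih.1 (linearityDefect_range_le_of_isBettiSplitting φ₂ φ₁ hsplit₂ hint₁ h)⟩
  have h1 : linearityDefect R (LinearMap.range φ₁) = ⊤ :=
    ENat.eq_top_iff_forall_gt.2 fun d => not_le.1 (key d).1
  have h2 : linearityDefect R (LinearMap.range φ₂) = ⊤ :=
    ENat.eq_top_iff_forall_gt.2 fun d => not_le.1 (key d).2
  exact ⟨h1, h2, fun h => (h (LinearMap.range φ₁)).ne h1⟩
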